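/- There is an absolute constant $C>0$ such that the following holds. Let $N\geq 1$ and $M$ be natural numbers, let $A\in\mathbb{Z}^{M\times N}$ and $b\in\mathbb{R}^M$, and suppose that $P=\{x\in\mathbb{R}^N_{\geq 0} \mid Ax=b\}$ is a polytope, i.e. bounded. Let $\Delta=\|A\|_\infty$ be the largest absolute value of an entry of $A$. Then the integer hull of $P$, i.e. the convex hull of $P\cap\mathbb{Z}^N$, has finitely many vertices, and their number is at most \[N^M\cdot\bigl(C\cdot M\log(\max\{2,M\Delta\})\bigr)^N .\] That is, the number of vertices is at most $N^M\cdot O(M\log(M\Delta))^N$, with a bound that does not depend on $b$ (where $M\Delta$ is replaced by $2$ inside the logarithm in the degenerate case $M\Delta=1$). -/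

import Mathlib

/-- The largest absolute value of an entry of an integer matrix, `‖A‖_∞`
(equal to `0` if the matrix has no entries). -/
def maxAbsEntry {M N : ℕ} (A : Matrix (Fin M) (Fin N) ℤ) : ℕ :=
  Finset.univ.sup fun i => Finset.univ.sup fun j => (A i j).natAbs

/-- The polyhedron `{x ∈ ℝ^N | x ≥ 0, A x = b}`. -/
def standardPolyhedron {M N : ℕ} (A : Matrix (Fin M) (Fin N) ℤ) (b : Fin M → ℝ) :
    Set (Fin N → ℝ) :=
  {x | 0 ≤ x ∧ (A.map (Int.cast : ℤ → ℝ)).mulVec x = b}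

/-- The integer hull of `P ⊆ ℝ^N`: the convex hull of `P ∩ ℤ^N`. -/
def integerHull {N : ℕ} (P : Set (Fin N → ℝ)) : Set (Fin N → ℝ) :=
  convexHull ℝ (P ∩ Set.range fun (z : Fin N → ℤ) (j : Fin N) => (z j : ℝ))

/-! A vertex `x` is the midpoint of `x + z` and `x - z`, so no nonzero integer kernel vector has
`|z| ≤ x` coordinatewise (`IsRigid`). Solutions of one system with equal binary lengths differ by
such a `z`, so the lengths determine a vertex (`IsRigid.eq_of_size_eq`) and it suffices to count
length vectors. Let `D = minorBound A`. Coordinates below `D` have few lengths. The columns of the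
set `S` of coordinates at least `D` are independent, since a dependence from Cramer's rule has
entries at most `D` (`IsRigid.exists_selection_eq`); hence `|S| ≤ M`. Once `S` is fixed, Cramer's
rule bounds differences on `S` by `N * D ^ 2` (`abs_kernel_le`), which confines the lengths to a
window independent of `b`. There are at most `2 * N ^ M` choices of `S`, and the `log N` in the
window costs only a factor `N ≤ 2 ^ N` (`pow_mul_pow_le_of_le_one_add_log_div`). -/

/-- The columns of `A` followed by the standard unit vectors. -/
def extendedColumn {M N : ℕ} (A : Matrix (Fin M) (Fin N) ℤ) : Fin N ⊕ Fin M → Fin M → ℤ :=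
  Sum.elim (fun j i => A i j) (fun k => Pi.single k 1)

/-- The square matrix whose columns are the extended columns of `A` selected by `e`. -/
def selectedColumns {M N : ℕ} (A : Matrix (Fin M) (Fin N) ℤ) (e : Fin M → Fin N ⊕ Fin M) :
    Matrix (Fin M) (Fin M) ℤ :=
  Matrix.of fun i k => extendedColumn A (e k) i

theorem natAbs_le_maxAbsEntry {M N : ℕ} (A : Matrix (Fin M) (Fin N) ℤ) (i : Fin M) (j : Fin N) :
    (A i j).natAbs ≤ maxAbsEntry A :=
  (Finset.le_sup (f := fun j => (A i j).natAbs) (Finset.mem_univ j)).trans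
    (Finset.le_sup (f := fun i => Finset.univ.sup fun j => (A i j).natAbs) (Finset.mem_univ i))

theorem abs_extendedColumn_le {M N : ℕ} {A : Matrix (Fin M) (Fin N) ℤ} (hA : 1 ≤ maxAbsEntry A)
    (c : Fin N ⊕ Fin M) (i : Fin M) : |extendedColumn A c i| ≤ (maxAbsEntry A : ℤ) := by
  rcases c with j | k
  · simp only [extendedColumn, Sum.elim_inl, Int.abs_eq_natAbs]
    exact_mod_cast natAbs_le_maxAbsEntry A i j
  · simp only [extendedColumn, Sum.elim_inr, Pi.single_apply]
    split_ifs
    · simpa using hA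
    · simp

/-- An upper bound for the minors of `A`. -/
def minorBound {M N : ℕ} (A : Matrix (Fin M) (Fin N) ℤ) : ℕ :=
  M.factorial * maxAbsEntry A ^ M

theorem abs_det_selectedColumns_le {M N : ℕ} {A : Matrix (Fin M) (Fin N) ℤ}
    (hA : 1 ≤ maxAbsEntry A) (e : Fin M → Fin N ⊕ Fin M) :
    |(selectedColumns A e).det| ≤ (minorBound A : ℤ) := by
  have := Matrix.det_le (A := selectedColumns A e) (abv := AbsoluteValue.abs)
    (x := (maxAbsEntry A : ℤ)) (fun i k => abs_extendedColumn_le hA (e k) i)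
  simpa [minorBound] using this

theorem abs_cramer_selectedColumns_le {M N : ℕ} {A : Matrix (Fin M) (Fin N) ℤ}
    (hA : 1 ≤ maxAbsEntry A) (e : Fin M → Fin N ⊕ Fin M) (c : Fin N ⊕ Fin M) (k : Fin M) :
    |(selectedColumns A e).cramer (extendedColumn A c) k| ≤ (minorBound A : ℤ) := by
  have : (selectedColumns A e).updateCol k (extendedColumn A c) =
      selectedColumns A (Function.update e k c) := by
    ext i l
    by_cases h : l = k
    · subst h; simp [selectedColumns]
    · simp [selectedColumns, h]
  rw [Matrix.cramer_apply, this]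
  exact abs_det_selectedColumns_le hA _

theorem cramer_selectedColumns_self {M N : ℕ} (A : Matrix (Fin M) (Fin N) ℤ)
    (e : Fin M → Fin N ⊕ Fin M) (k : Fin M) :
    (selectedColumns A e).cramer (extendedColumn A (e k)) =
      Pi.single k (selectedColumns A e).det :=
  Matrix.cramer_row_self _ _ k fun _ => rfl

/-- A maximal independent set of columns of `A` with index in `S` can be completed by extended
columns to a nonsingular square matrix. -/
theorem exists_nonsingular_selection {M N : ℕ} (A : Matrix (Fin M) (Fin N) ℤ) (S : Set (Fin N)) :
    ∃ e : Fin M → Fin N ⊕ Fin M, Function.Injective e ∧ (selectedColumns A e).det ≠ 0 ∧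
      ∀ i ∈ S, ∀ k, e k ∉ Sum.inl '' S →
        (selectedColumns A e).cramer (extendedColumn A (Sum.inl i)) k = 0 := by
  classical
  let v : Fin N ⊕ Fin M → Fin M → ℚ := fun c i => (extendedColumn A c i : ℚ)
  obtain ⟨b₀, hb₀S, -, hspan₀, hli₀⟩ := exists_linearIndepOn_extension (K := ℚ) (v := v)
    (s := ∅) (t := Sum.inl '' S) (linearIndepOn_empty _ _) (Set.empty_subset _)
  obtain ⟨b, -, hb₀b, hspan, hli⟩ := exists_linearIndepOn_extension (K := ℚ) (v := v)
    (s := b₀) (t := Set.univ) hli₀ (Set.subset_univ _)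
  have htop : ⊤ ≤ Submodule.span ℚ (Set.range fun c : b => v c) := by
    have hr : (Set.range fun c : b => v c) = v '' b := by
      ext w; simp
    rw [hr, ← (Pi.basisFun ℚ (Fin M)).span_eq, Submodule.span_le]
    rintro _ ⟨k, rfl⟩
    refine hspan ⟨Sum.inr k, trivial, ?_⟩
    ext i
    simp [v, extendedColumn, Pi.single_apply]
  let B : Module.Basis b ℚ (Fin M → ℚ) := Module.Basis.mk hli htop
  have hcard : Fintype.card b = M := by
    simpa using (Module.finrank_eq_card_basis B).symm
  let f : Fin M ≃ b := (Fintype.equivFinOfCardEq hcard).symm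
  let e : Fin M → Fin N ⊕ Fin M := fun k => (f k : Fin N ⊕ Fin M)
  let Q : Matrix (Fin M) (Fin M) ℚ := (selectedColumns A e).map (Int.castRingHom ℚ)
  have hQdet : Q.det = ((selectedColumns A e).det : ℚ) :=
    ((Int.castRingHom ℚ).map_det _).symm
  have hQcol : Q.col = fun k => v (e k) := by
    ext k i
    simp [Q, v, selectedColumns, Matrix.col]
  have hdet : IsUnit Q := by
    rw [← Matrix.linearIndependent_cols_iff_isUnit, hQcol]
    exact hli.comp f f.injective
  refine ⟨e, Subtype.val_injective.comp f.injective, ?_, ?_⟩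
  · intro h0
    rw [Matrix.isUnit_iff_isUnit_det, hQdet, h0] at hdet
    simp at hdet
  · intro i hi k hk
    have hmem : v (Sum.inl i) ∈ Submodule.span ℚ (v '' b₀) := hspan₀ ⟨_, ⟨i, hi, rfl⟩, rfl⟩
    -- The `k`-th Cramer coordinate kills every selected column other than the `k`-th, hence all of
    -- `b₀`.
    have hle : Submodule.span ℚ (v '' b₀) ≤ LinearMap.ker (LinearMap.proj k ∘ₗ Q.cramer) := by
      rw [Submodule.span_le]
      rintro _ ⟨c, hc, rfl⟩
      obtain ⟨l, hl⟩ := f.surjective ⟨c, hb₀b hc⟩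
      have hl' : e l = c := congrArg Subtype.val hl
      have hlk : k ≠ l := by
        rintro rfl
        exact hk (hl' ▸ hb₀S hc)
      have : Q.cramer (v c) = Pi.single l Q.det :=
        Matrix.cramer_row_self _ _ l fun i => by rw [← hl']; exact (congrFun (congrFun hQcol l) i).symm
      simp [this, hlk]
    have h0 : Q.cramer (v (Sum.inl i)) k = 0 := by simpa using hle hmem
    rw [Matrix.cramer_apply] at h0 ⊢
    have hmap : Q.updateCol k (v (Sum.inl i)) =
        ((selectedColumns A e).updateCol k (extendedColumn A (Sum.inl i))).map
          (Int.castRingHom ℚ) := by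
      rw [Matrix.map_updateCol]; rfl
    rw [hmap] at h0
    have h1 := ((Int.castRingHom ℚ).map_det
      ((selectedColumns A e).updateCol k (extendedColumn A (Sum.inl i))))
    rw [RingHom.mapMatrix_apply, h0] at h1
    simpa using h1

/-! ### Rigid vectors and their large coordinates -/

/-- A nonnegative integer vector from which no nonzero integer kernel vector of `A` can be both
added and subtracted without leaving the nonnegative orthant. -/
def IsRigid {M N : ℕ} (A : Matrix (Fin M) (Fin N) ℤ) (x : Fin N → ℕ) : Prop :=
  ∀ z : Fin N → ℤ, A.mulVec z = 0 → (∀ j, |z j| ≤ (x j : ℤ)) → z = 0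

/-- Otherwise Cramer's rule writes `det` times column `i` through selected columns from `S`, giving
a nonzero kernel vector supported on `S` with entries at most `minorBound A`, against rigidity. -/
theorem IsRigid.exists_selection_eq {M N : ℕ} {A : Matrix (Fin M) (Fin N) ℤ}
    (hA : 1 ≤ maxAbsEntry A) {x : Fin N → ℕ} (hx : IsRigid A x) {S : Set (Fin N)}
    (hS : ∀ j ∈ S, minorBound A ≤ x j) {e : Fin M → Fin N ⊕ Fin M} (he : Function.Injective e)
    (hdet : (selectedColumns A e).det ≠ 0)
    (hcr : ∀ i ∈ S, ∀ k, e k ∉ Sum.inl '' S →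
      (selectedColumns A e).cramer (extendedColumn A (Sum.inl i)) k = 0)
    {i : Fin N} (hi : i ∈ S) : ∃ k, e k = Sum.inl i := by
  classical
  by_contra hne
  push Not at hne
  set w := (selectedColumns A e).cramer (extendedColumn A (Sum.inl i)) with hw
  set d := (selectedColumns A e).det with hd
  let s : Fin N → ℤ := fun j => ∑ k, if e k = Sum.inl j then w k else 0
  let z : Fin N → ℤ := fun j => s j - if j = i then d else 0
  have hsi : s i = 0 := Finset.sum_eq_zero fun k _ => by simp [hne k]
  have hzi : z i = -d := by simp [z, hsi]
  have hs : ∀ j, |s j| ≤ (x j : ℤ) := by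
    intro j
    by_cases h : ∃ k, e k = Sum.inl j
    · obtain ⟨k, hk⟩ := h
      have hsj : s j = w k := by
        refine (Finset.sum_eq_single k (fun l _ hl => ?_) (by simp)).trans (by simp [hk])
        rw [if_neg]
        exact fun h => hl (he (h.trans hk.symm))
      rw [hsj]
      by_cases hj : j ∈ S
      · exact (abs_cramer_selectedColumns_le hA e _ k).trans (by exact_mod_cast hS j hj)
      · rw [hw, hcr i hi k (by rw [hk]; simpa using hj)]
        simp
    · push Not at h
      have hsj : s j = 0 := Finset.sum_eq_zero fun k _ => by simp [h k]
      simp [hsj]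
  have hker : A.mulVec z = 0 := by
    ext r
    have hB := congrFun (Matrix.mulVec_cramer (selectedColumns A e)
      (extendedColumn A (Sum.inl i))) r
    rw [← hw, ← hd] at hB
    have hterm : ∀ k, ∑ j, A r j * (if e k = Sum.inl j then w k else 0) =
        selectedColumns A e r k * w k := by
      intro k
      rcases hk : e k with j | l
      · simp [selectedColumns, extendedColumn, hk]
      · have : w k = 0 := hcr i hi k (by rw [hk]; simp)
        simp [this]
    have hsum : ∑ j, A r j * s j = d * A r i := by
      simp only [s, Finset.mul_sum]
      rw [Finset.sum_comm, Finset.sum_congr rfl fun k _ => hterm k]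
      simpa [Matrix.mulVec, dotProduct, extendedColumn] using hB
    simp only [Matrix.mulVec, dotProduct, z, mul_sub, Finset.sum_sub_distrib, hsum]
    simp [mul_comm]
  have hz0 := hx z hker fun j => by
    by_cases hj : j = i
    · subst hj
      rw [hzi, abs_neg]
      exact (abs_det_selectedColumns_le hA e).trans (by exact_mod_cast hS j hi)
    · simpa [z, hj] using hs j
  rw [hz0] at hzi
  exact hdet (by simpa [eq_comm] using hzi)

/-- The Cramer coordinate belonging to `j` kills the other columns of `S`, so it expresses `det * z
j` through coordinates outside `S`. -/
theorem abs_kernel_le {M N : ℕ} {A : Matrix (Fin M) (Fin N) ℤ}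
    (hA : 1 ≤ maxAbsEntry A) {S : Set (Fin N)} {e : Fin M → Fin N ⊕ Fin M}
    (hdet : (selectedColumns A e).det ≠ 0) (hSe : ∀ i ∈ S, ∃ k, e k = Sum.inl i)
    {z : Fin N → ℤ} (hz : A.mulVec z = 0) (hzS : ∀ i ∉ S, |z i| ≤ (minorBound A : ℤ))
    {j : Fin N} (hj : j ∈ S) : |z j| ≤ ((N * minorBound A ^ 2 : ℕ) : ℤ) := by
  classical
  obtain ⟨k, hk⟩ := hSe j hj
  set c : Fin N → ℤ := fun i => (selectedColumns A e).cramer (extendedColumn A (Sum.inl i)) k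
    with hc
  have hcomb : ∑ i, z i • extendedColumn A (Sum.inl i) = 0 := by
    rw [← hz]
    ext r
    simp [Matrix.mulVec, dotProduct, extendedColumn, mul_comm]
  have hsum : ∑ i, z i * c i = 0 := by
    have := congrFun (congrArg (selectedColumns A e).cramer hcomb) k
    simpa only [map_sum, map_smul, Finset.sum_apply, Pi.smul_apply, smul_eq_mul, map_zero,
      Pi.zero_apply] using this
  have hcj : c j = (selectedColumns A e).det := by
    simp only [hc]
    rw [← hk, cramer_selectedColumns_self]
    simp
  have hterm : ∀ i ∈ Finset.univ.erase j, |z i * c i| ≤ (minorBound A : ℤ) ^ 2 := by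
    intro i hi
    by_cases hiS : i ∈ S
    · obtain ⟨l, hl⟩ := hSe i hiS
      have hkl : k ≠ l := by
        rintro rfl
        exact (Finset.ne_of_mem_erase hi) (Sum.inl_injective (hl.symm.trans hk))
      have : c i = 0 := by
        simp only [hc]
        rw [← hl, cramer_selectedColumns_self]
        simp [hkl]
      rw [this]
      simp
    · rw [abs_mul, sq]
      exact mul_le_mul (hzS i hiS) (abs_cramer_selectedColumns_le hA e _ k) (abs_nonneg _)
        (Int.natCast_nonneg _)
  rw [← Finset.add_sum_erase _ _ (Finset.mem_univ j), hcj] at hsum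
  have hd1 : 1 ≤ |(selectedColumns A e).det| := Int.one_le_abs hdet
  calc |z j| ≤ |z j| * |(selectedColumns A e).det| := le_mul_of_one_le_right (abs_nonneg _) hd1
    _ = |∑ i ∈ Finset.univ.erase j, z i * c i| := by
      rw [← abs_mul, ← abs_neg, neg_eq_of_add_eq_zero_right hsum]
    _ ≤ ∑ i ∈ Finset.univ.erase j, |z i * c i| := Finset.abs_sum_le_sum_abs _ _
    _ ≤ ∑ i ∈ Finset.univ.erase j, (minorBound A : ℤ) ^ 2 := Finset.sum_le_sum hterm
    _ ≤ ∑ i : Fin N, (minorBound A : ℤ) ^ 2 :=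
      Finset.sum_le_sum_of_subset_of_nonneg (Finset.erase_subset _ _) fun _ _ _ => sq_nonneg _
    _ = ((N * minorBound A ^ 2 : ℕ) : ℤ) := by simp

/-! ### Counting by binary length -/

theorem Nat.le_two_mul_of_size_eq {a b : ℕ} (h : a.size = b.size) : b ≤ 2 * a := by
  rcases Nat.eq_zero_or_pos a with rfl | ha
  · rw [Nat.size_zero, eq_comm, Nat.size_eq_zero] at h
    simp [h]
  · have hpos := Nat.size_pos.2 ha
    have h1 : 2 ^ (a.size - 1) ≤ a := Nat.lt_size.1 (by omega)
    have h2 := Nat.lt_size_self b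
    rw [← h, show a.size = (a.size - 1) + 1 by omega, pow_succ] at h2
    omega

theorem Nat.size_mul_le (a b : ℕ) : (a * b).size ≤ a.size + b.size := by
  rw [Nat.size_le, pow_add]
  exact Nat.mul_lt_mul'' (Nat.lt_size_self a) (Nat.lt_size_self b)

theorem IsRigid.eq_of_size_eq {M N : ℕ} {A : Matrix (Fin M) (Fin N) ℤ} {x y : Fin N → ℕ}
    (hx : IsRigid A x)
    (hxy : A.mulVec (fun j => (x j : ℤ)) = A.mulVec (fun j => (y j : ℤ)))
    (h : ∀ j, (x j).size = (y j).size) : x = y := by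
  have hz := hx ((fun j => (x j : ℤ)) - fun j => (y j : ℤ))
    (by rw [Matrix.mulVec_sub, hxy, sub_self]) fun j => by
      have := Nat.le_two_mul_of_size_eq (h j)
      rw [Pi.sub_apply, abs_le]
      constructor <;> omega
  ext j
  have := congrFun hz j
  simp only [Pi.sub_apply, Pi.zero_apply] at this
  omega

theorem minorBound_pos {M N : ℕ} {A : Matrix (Fin M) (Fin N) ℤ} (hA : 1 ≤ maxAbsEntry A) :
    1 ≤ minorBound A :=
  Nat.mul_pos (Nat.factorial_pos M) (Nat.pow_pos hA)

theorem Nat.size_le_size_add_size {a b w : ℕ} (hb : 1 ≤ b) (h : a ≤ b + w) :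
    -- Since `1 ≤ b`, `b + w ≤ b * (1 + w)`.
    a.size ≤ b.size + (1 + w).size :=
  (Nat.size_le_size (by nlinarith)).trans (Nat.size_mul_le b (1 + w))

/-- Pairwise distinct rigid solutions of one system, with the same set `S` of large coordinates,
are few. -/
theorem ncard_rigid_le {M N : ℕ} {A : Matrix (Fin M) (Fin N) ℤ} (hA : 1 ≤ maxAbsEntry A)
    {V : Set (Fin N → ℕ)} (hV : ∀ x ∈ V, IsRigid A x)
    (hAV : ∀ x ∈ V, ∀ y ∈ V, A.mulVec (fun j => (x j : ℤ)) = A.mulVec (fun j => (y j : ℤ)))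
    (S : Finset (Fin N)) (hS : ∀ x ∈ V, ∀ j, j ∈ S ↔ minorBound A ≤ x j) :
    V.Finite ∧ (V.Nonempty → S.card ≤ M) ∧
      V.ncard ≤ ((minorBound A).size + 1) ^ (N - S.card) *
        (2 * (1 + N * minorBound A ^ 2).size + 1) ^ S.card := by
  classical
  rcases V.eq_empty_or_nonempty with rfl | ⟨y, hy⟩
  · simp
  obtain ⟨e, he, hdet, hcr⟩ := exists_nonsingular_selection A (S : Set (Fin N))
  have hSe : ∀ i ∈ (S : Set (Fin N)), ∃ k, e k = Sum.inl i := fun i hi =>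
    (hV y hy).exists_selection_eq hA (fun j hj => (hS y hy j).1 hj) he hdet hcr hi
  set D := minorBound A with hD
  set T := (1 + N * D ^ 2).size with hT
  have hclose : ∀ x ∈ V, ∀ x' ∈ V, ∀ j ∈ S, (x j).size ≤ (x' j).size + T := by
    intro x hx x' hx' j hj
    have h1 : 1 ≤ x' j := (minorBound_pos hA).trans ((hS x' hx' j).1 hj)
    refine Nat.size_le_size_add_size h1 ?_
    have := abs_kernel_le hA hdet hSe (z := (fun j => (x j : ℤ)) - fun j => (x' j : ℤ))
      (by rw [Matrix.mulVec_sub, hAV x hx x' hx', sub_self])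
      (fun i hi => by
        have h2 := mt (hS x hx i).2 hi
        have h3 := mt (hS x' hx' i).2 hi
        rw [Pi.sub_apply, abs_le]
        constructor <;> omega) (j := j) hj
    rw [Pi.sub_apply] at this
    have := (abs_le.1 this).2
    rw [← hD] at this
    omega
  let box : Fin N → Finset ℕ := fun j =>
    if j ∈ S then Finset.Icc ((y j).size - T) ((y j).size + T) else Finset.range (D.size + 1)
  let F : (Fin N → ℕ) → Fin N → ℕ := fun x j => (x j).size
  have hmaps : ∀ x ∈ V, F x ∈ (Fintype.piFinset box : Set (Fin N → ℕ)) := by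
    intro x hx
    rw [Finset.mem_coe, Fintype.mem_piFinset]
    intro j
    by_cases hj : j ∈ S
    · have h1 := hclose x hx y hy j hj
      have h2 := hclose y hy x hx j hj
      simp only [box, F, hj, if_true, Finset.mem_Icc]
      omega
    · have h1 : (x j).size ≤ D.size :=
        Nat.size_le_size (by have := mt (hS x hx j).2 hj; omega)
      simp only [box, F, hj, if_false, Finset.mem_range]
      omega
  have hinj : Set.InjOn F V := fun x hx x' hx' h =>
    (hV x hx).eq_of_size_eq (hAV x hx x' hx') fun j => congrFun h j
  have hfin : V.Finite := Set.Finite.of_injOn hmaps hinj (Finset.finite_toSet _)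
  refine ⟨hfin, fun _ => ?_, ?_⟩
  · choose g hg using fun i : S => hSe i i.2
    have hgi : Function.Injective g := fun i i' h => by
      have := (hg i).symm.trans ((congrArg e h).trans (hg i'))
      exact Subtype.ext (Sum.inl_injective this)
    simpa using Fintype.card_le_of_injective g hgi
  · have hbox : ∀ j, (box j).card ≤ if j ∈ S then 2 * T + 1 else D.size + 1 := by
      intro j
      by_cases hj : j ∈ S
      · simp only [box, hj, if_true, Nat.card_Icc]
        omega
      · simp [box, hj]
    calc V.ncard ≤ (Fintype.piFinset box : Set (Fin N → ℕ)).ncard :=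
          Set.ncard_le_ncard_of_injOn F hmaps hinj (Finset.finite_toSet _)
      _ = ∏ j, (box j).card := by rw [Set.ncard_coe_finset, Fintype.card_piFinset]
      _ ≤ ∏ j, if j ∈ S then 2 * T + 1 else D.size + 1 :=
          Finset.prod_le_prod' fun j _ => hbox j
      _ = _ := by
          rw [Finset.prod_ite]
          have h1 : Finset.univ.filter (fun j => j ∈ S) = S := by ext; simp
          have h2 : Finset.univ.filter (fun j => j ∉ S) = Sᶜ := by ext; simp
          rw [h1, h2, Finset.prod_const, Finset.prod_const, Finset.card_compl, Fintype.card_fin,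
            mul_comm]

/-- A nonempty set of size at most `M` is the image of a map from `Fin M`; the factor 2 makes room
for the empty set. -/
theorem card_filter_card_le {M N : ℕ} (hN : 1 ≤ N) :
    (Finset.univ.filter fun S : Finset (Fin N) => S.card ≤ M).card ≤ 2 * N ^ M := by
  classical
  have hsub : (Finset.univ.filter fun S : Finset (Fin N) => S.card ≤ M) ⊆
      insert ∅ (Finset.univ.image fun f : Fin M → Fin N => Finset.univ.image f) := by
    intro S hS
    rw [Finset.mem_filter] at hS
    rw [Finset.mem_insert, Finset.mem_image]
    rcases S.eq_empty_or_nonempty with h | ⟨s, hs⟩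
    · exact Or.inl h
    right
    have hle : Fintype.card S ≤ Fintype.card (Fin M) := by simpa using hS.2
    obtain ⟨g⟩ := Function.Embedding.nonempty_of_card_le hle
    have : Nonempty S := ⟨⟨s, hs⟩⟩
    refine ⟨fun k => (Function.invFun g k : S), Finset.mem_univ _, ?_⟩
    ext i
    simp only [Finset.mem_image, Finset.mem_univ, true_and]
    constructor
    · rintro ⟨k, rfl⟩
      exact Subtype.prop _
    · intro hi
      exact ⟨g ⟨i, hi⟩, by rw [Function.leftInverse_invFun g.injective]⟩
  have h1 := (Finset.card_le_card hsub).trans (Finset.card_insert_le _ _)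
  have h2 : (Finset.univ.image fun f : Fin M → Fin N => Finset.univ.image f).card ≤ N ^ M :=
    Finset.card_image_le.trans (by simp)
  have h3 : 1 ≤ N ^ M := Nat.one_le_pow _ _ hN
  omega

/-! ### Real estimates -/

theorem Nat.size_le_log {n : ℕ} (hn : 1 ≤ n) :
    (n.size : ℝ) ≤ 3 / 2 * Real.log n + 1 := by
  have hpos := Nat.size_pos.2 hn
  have h1 : 2 ^ (n.size - 1) ≤ n := Nat.lt_size.1 (by omega)
  have h2 : ((2 : ℝ) ^ (n.size - 1)) ≤ n := by exact_mod_cast h1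
  have h3 := Real.log_le_log (by positivity) h2
  rw [Real.log_pow, Nat.cast_sub hpos] at h3
  have h4 := Real.log_two_gt_d9
  have h5 : (1 : ℝ) ≤ n.size := by exact_mod_cast hpos
  push_cast at h3
  nlinarith

theorem pow_mul_pow_le_of_le_one_add_log_div {M N k : ℕ} (hM : 1 ≤ M) (hN : 1 ≤ N) (hkM : k ≤ M)
    (hkN : k ≤ N) {a p q : ℝ} (hp : 0 ≤ p) (hq : 0 ≤ q) (ha : 0 ≤ a) (hpa : p ≤ a)
    (hqa : q ≤ a * (1 + Real.log N / M)) : p ^ (N - k) * q ^ k ≤ N * a ^ N := by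
  have hM0 : (0 : ℝ) < M := by exact_mod_cast hM
  have hN0 : (0 : ℝ) < N := by exact_mod_cast hN
  have hlog : 0 ≤ Real.log N := Real.log_natCast_nonneg N
  have ht : 0 ≤ Real.log N / M := by positivity
  have hexp : (1 + Real.log N / M) ^ k ≤ N := by
    calc (1 + Real.log N / M) ^ k ≤ Real.exp (Real.log N / M) ^ k := by
          gcongr
          linarith [Real.add_one_le_exp (Real.log N / M)]
      _ = Real.exp (k * (Real.log N / M)) := (Real.exp_nat_mul _ _).symm
      _ ≤ Real.exp (Real.log N) := by
          apply Real.exp_le_exp.2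
          rw [mul_div_assoc', div_le_iff₀ hM0, mul_comm]
          gcongr
      _ = N := Real.exp_log hN0
  calc p ^ (N - k) * q ^ k ≤ a ^ (N - k) * (a * (1 + Real.log N / M)) ^ k := by gcongr
    _ = a ^ N * (1 + Real.log N / M) ^ k := by
        rw [mul_pow, ← mul_assoc, ← pow_add, Nat.sub_add_cancel hkN]
    _ ≤ a ^ N * N := by gcongr
    _ = N * a ^ N := mul_comm _ _

/-- As `1 ≤ M ≤ 3/2 * K`, the second length count is at most `11 + 6 * K + 3 * log N`, and `11 * 3/2
+ 6 < 23`. -/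
theorem size_bounds {M N D : ℕ} (hM : 1 ≤ M) (hN : 1 ≤ N) (hD : 1 ≤ D) {K : ℝ}
    (hDK : Real.log D ≤ K) (hMK : M * Real.log 2 ≤ K) :
    ((D.size + 1 : ℕ) : ℝ) ≤ 23 * K ∧
      ((2 * (1 + N * D ^ 2).size + 1 : ℕ) : ℝ) ≤ 23 * K * (1 + Real.log N / M) := by
  have hM1 : (1 : ℝ) ≤ M := by exact_mod_cast hM
  have hlog : 0 ≤ Real.log N := Real.log_natCast_nonneg N
  have hl2 := Real.log_two_gt_d9
  have hMK' : (M : ℝ) ≤ 3 / 2 * K := by nlinarith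
  have hsD := Nat.size_le_log hD
  have hsN := Nat.size_le_log hN
  have hND : 1 ≤ N * D ^ 2 := Nat.mul_pos hN (Nat.pow_pos hD)
  have hT : (1 + N * D ^ 2).size ≤ 2 + (N.size + (D.size + D.size)) := by
    refine (Nat.size_le_size (show 1 + N * D ^ 2 ≤ 2 * (N * (D * D)) by nlinarith)).trans ?_
    refine (Nat.size_mul_le _ _).trans (Nat.add_le_add (by decide) ?_)
    exact (Nat.size_mul_le _ _).trans (Nat.add_le_add_left (Nat.size_mul_le _ _) _)
  have hT' : ((1 + N * D ^ 2).size : ℝ) ≤ 2 + (N.size + (D.size + D.size)) := by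
    exact_mod_cast hT
  have hlogN : Real.log N ≤ 3 / 2 * K * (Real.log N / M) := by
    rw [mul_div_assoc', le_div_iff₀ (by linarith)]
    nlinarith
  constructor
  · rw [Nat.cast_add, Nat.cast_one]
    linarith
  · rw [Nat.cast_add, Nat.cast_mul, Nat.cast_one, Nat.cast_two]
    linarith

theorem minorBound_le_pow {M N : ℕ} (A : Matrix (Fin M) (Fin N) ℤ) :
    minorBound A ≤ (M * maxAbsEntry A) ^ M := by
  rw [mul_pow]
  exact Nat.mul_le_mul_right _ (Nat.factorial_le_pow M)

theorem ncard_rigid_le_real {M N : ℕ} {A : Matrix (Fin M) (Fin N) ℤ} (hM : 1 ≤ M) (hN : 1 ≤ N)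
    (hA : 1 ≤ maxAbsEntry A) {V : Set (Fin N → ℕ)} (hV : ∀ x ∈ V, IsRigid A x)
    (hAV : ∀ x ∈ V, ∀ y ∈ V, A.mulVec (fun j => (x j : ℤ)) = A.mulVec (fun j => (y j : ℤ))) :
    V.Finite ∧ (V.ncard : ℝ) ≤ (N : ℝ) ^ M *
      (92 * ((M : ℝ) * Real.log (max 2 ((M : ℝ) * (maxAbsEntry A : ℝ))))) ^ N := by
  classical
  set D := minorBound A with hD
  set K : ℝ := (M : ℝ) * Real.log (max 2 ((M : ℝ) * (maxAbsEntry A : ℝ))) with hK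
  have hDpos : 1 ≤ D := minorBound_pos hA
  have hlog2 := Real.log_two_gt_d9
  have hMK : (M : ℝ) * Real.log 2 ≤ K := by
    rw [hK]
    gcongr
    exact le_max_left _ _
  have hDK : Real.log D ≤ K := by
    have h1 : (D : ℝ) ≤ ((M : ℝ) * (maxAbsEntry A : ℝ)) ^ M := by
      exact_mod_cast minorBound_le_pow A
    have h2 : (D : ℝ) ≤ (max 2 ((M : ℝ) * (maxAbsEntry A : ℝ))) ^ M :=
      h1.trans (pow_le_pow_left₀ (by positivity) (le_max_right _ _) M)
    have h3 := Real.log_le_log (by exact_mod_cast hDpos) h2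
    rwa [Real.log_pow] at h3
  have hK0 : 0 ≤ K := le_trans (by positivity) hMK
  obtain ⟨hp, hq⟩ := size_bounds hM hN hDpos hDK hMK
  let large : (Fin N → ℕ) → Finset (Fin N) := fun x => Finset.univ.filter fun j => D ≤ x j
  let W : Finset (Fin N) → Set (Fin N → ℕ) := fun S => {x ∈ V | large x = S}
  have hW : ∀ S, (W S).Finite ∧ ((W S).Nonempty → S.card ≤ M) ∧ (W S).ncard ≤
      (D.size + 1) ^ (N - S.card) * (2 * (1 + N * D ^ 2).size + 1) ^ S.card := fun S =>
    ncard_rigid_le hA (fun x hx => hV x hx.1) (fun x hx y hy => hAV x hx.1 y hy.1) S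
      fun x hx j => by rw [← hx.2]; simp [large, D]
  let 𝒮 := Finset.univ.filter fun S : Finset (Fin N) => S.card ≤ M
  have hVW : V = ⋃ S ∈ 𝒮, W S := by
    ext x
    simp only [Set.mem_iUnion]
    constructor
    · intro hx
      have hxW : x ∈ W (large x) := ⟨hx, rfl⟩
      exact ⟨large x, Finset.mem_filter.2 ⟨Finset.mem_univ _, (hW _).2.1 ⟨x, hxW⟩⟩, hxW⟩
    · rintro ⟨S, -, hx⟩
      exact hx.1
  have hWcard : ∀ S ∈ 𝒮, ((W S).ncard : ℝ) ≤ N * (23 * K) ^ N := by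
    intro S hS
    have h1 : ((W S).ncard : ℝ) ≤ ((D.size + 1 : ℕ) : ℝ) ^ (N - S.card) *
        ((2 * (1 + N * D ^ 2).size + 1 : ℕ) : ℝ) ^ S.card := by
      exact_mod_cast (hW S).2.2
    exact h1.trans (pow_mul_pow_le_of_le_one_add_log_div hM hN (Finset.mem_filter.1 hS).2
      (by simpa using S.card_le_univ) (by positivity) (by positivity) (by positivity) hp hq)
  refine ⟨hVW ▸ 𝒮.finite_toSet.biUnion fun S _ => (hW S).1, ?_⟩
  have hsum : (V.ncard : ℝ) ≤ ∑ S ∈ 𝒮, ((W S).ncard : ℝ) := by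
    have := Finset.set_ncard_biUnion_le 𝒮 W
    rw [← hVW] at this
    exact_mod_cast this
  have h𝒮 : (𝒮.card : ℝ) ≤ 2 * (N : ℝ) ^ M := by exact_mod_cast card_filter_card_le hN
  -- The factors `N` and 2 move inside the `N`-th power, so `92 = 2 * 2 * 23`.
  have hN2 : (N : ℝ) ≤ 2 ^ N := by exact_mod_cast Nat.lt_two_pow_self.le
  have h22 : (2 : ℝ) ≤ 2 ^ N := le_self_pow₀ one_le_two (by omega)
  calc (V.ncard : ℝ) ≤ ∑ S ∈ 𝒮, ((W S).ncard : ℝ) := hsum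
    _ ≤ 𝒮.card * (N * (23 * K) ^ N) := by
        simpa using Finset.sum_le_card_nsmul _ _ _ hWcard
    _ ≤ (2 * (N : ℝ) ^ M) * (N * (23 * K) ^ N) := by gcongr
    _ ≤ (2 ^ N * (N : ℝ) ^ M) * (2 ^ N * (23 * K) ^ N) := by gcongr
    _ = (N : ℝ) ^ M * (2 * 2 * (23 * K)) ^ N := by
        rw [mul_pow (2 * 2), mul_pow 2 2]; ring
    _ = (N : ℝ) ^ M * (92 * K) ^ N := by ring_nf

/-! ### Vertices of the integer hull -/

theorem map_intCast_mulVec {M N : ℕ} (A : Matrix (Fin M) (Fin N) ℤ) (z : Fin N → ℤ) :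
    (A.map (Int.cast : ℤ → ℝ)).mulVec (fun j => (z j : ℝ)) = fun i => ((A.mulVec z i : ℤ) : ℝ) := by
  ext i
  simp [Matrix.mulVec, dotProduct]

theorem isRigid_of_mem_extremePoints {M N : ℕ} {A : Matrix (Fin M) (Fin N) ℤ} {b : Fin M → ℝ}
    {x : Fin N → ℕ}
    (hx : (fun j => (x j : ℝ)) ∈ (integerHull (standardPolyhedron A b)).extremePoints ℝ) :
    IsRigid A x := by
  intro z hz hzx
  have hxP := (extremePoints_convexHull_subset hx).1
  have hmem : ∀ w : Fin N → ℤ, A.mulVec w = 0 → (∀ j, |w j| ≤ (x j : ℤ)) →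
      ((fun j => (x j : ℝ)) + fun j => (w j : ℝ)) ∈ integerHull (standardPolyhedron A b) := by
    intro w hw hwx
    refine subset_convexHull ℝ _ ⟨⟨fun j => ?_, ?_⟩, ⟨fun j => x j + w j, ?_⟩⟩
    · have h1 : (0 : ℤ) ≤ x j + w j := by linarith [neg_le_of_abs_le (hwx j)]
      have h2 : ((0 : ℤ) : ℝ) ≤ ((x j + w j : ℤ) : ℝ) := by exact_mod_cast h1
      simpa using h2
    · rw [Matrix.mulVec_add, hxP.2, map_intCast_mulVec, hw]
      ext i
      simp
    · ext j
      simp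
  have h1 := hmem z hz hzx
  have h2 := hmem (-z) (by rw [Matrix.mulVec_neg, hz, neg_zero]) (by simpa using hzx)
  have h3 := hx.2 h1 h2 ⟨1 / 2, 1 / 2, by norm_num, by norm_num, by norm_num, by
    ext j
    simp
    ring⟩
  ext j
  have := congrFun h3 j
  simpa using this

theorem standardPolyhedron_eq_empty_of_isBounded_of_eq_zero {M N : ℕ}
    {A : Matrix (Fin M) (Fin N) ℤ} {b : Fin M → ℝ} (hN : 1 ≤ N) (hA : A = 0)
    (hP : Bornology.IsBounded (standardPolyhedron A b)) : standardPolyhedron A b = ∅ := by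
  rw [Set.eq_empty_iff_forall_notMem]
  intro x hx
  obtain ⟨R, hR⟩ := hP.exists_norm_le
  let j₀ : Fin N := ⟨0, hN⟩
  -- With `A = 0` every nonnegative vector is a solution once one is.
  have hmem : (fun _ => |R| + 1 : Fin N → ℝ) ∈ standardPolyhedron A b := by
    refine ⟨fun j => by simp only [Pi.zero_apply]; positivity, ?_⟩
    rw [← hx.2, hA]
    simp
  have h1 := (norm_le_pi_norm (fun _ => |R| + 1 : Fin N → ℝ) j₀).trans (hR _ hmem)
  rw [Real.norm_eq_abs] at h1
  linarith [le_abs_self (|R| + 1), le_abs_self R]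

theorem eq_zero_of_maxAbsEntry_eq_zero {M N : ℕ} {A : Matrix (Fin M) (Fin N) ℤ}
    (h : maxAbsEntry A = 0) : A = 0 := by
  ext i j
  have := natAbs_le_maxAbsEntry A i j
  simpa [h] using this

theorem theorem6 :
    ∃ C : ℝ, 0 < C ∧
      ∀ (M N : ℕ) (A : Matrix (Fin M) (Fin N) ℤ) (b : Fin M → ℝ),
        1 ≤ N →
        Bornology.IsBounded (standardPolyhedron A b) →
        ((integerHull (standardPolyhedron A b)).extremePoints ℝ).Finite ∧
        ((((integerHull (standardPolyhedron A b)).extremePoints ℝ).ncard : ℕ) : ℝ) ≤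
          (N : ℝ) ^ M *
            (C * ((M : ℝ) * Real.log (max 2 ((M : ℝ) * (maxAbsEntry A : ℝ))))) ^ N := by
  refine ⟨92, by norm_num, fun M N A b hN hP => ?_⟩
  rcases Nat.eq_zero_or_pos (maxAbsEntry A) with hA | hA
  · have hempty := standardPolyhedron_eq_empty_of_isBounded_of_eq_zero hN
      (eq_zero_of_maxAbsEntry_eq_zero hA) hP
    have hlog : 0 ≤ Real.log (max 2 ((M : ℝ) * (maxAbsEntry A : ℝ))) :=
      Real.log_nonneg (le_trans one_le_two (le_max_left _ _))
    have : (integerHull (standardPolyhedron A b)).extremePoints ℝ = ∅ :=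
      Set.subset_empty_iff.1 (extremePoints_subset.trans (by simp [hempty, integerHull]))
    rw [this]
    refine ⟨Set.finite_empty, ?_⟩
    rw [Set.ncard_empty, Nat.cast_zero]
    positivity
  · have hM : 1 ≤ M := by
      rcases Nat.eq_zero_or_pos M with rfl | hM
      · simp [maxAbsEntry] at hA
      · exact hM
    set E := (integerHull (standardPolyhedron A b)).extremePoints ℝ with hE
    let ι : (Fin N → ℕ) → Fin N → ℝ := fun x j => (x j : ℝ)
    have hι : Function.Injective ι := fun x y h => by
      ext j
      exact Nat.cast_injective (R := ℝ) (congrFun h j)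
    have hEι : E ⊆ Set.range ι := by
      intro x hx
      obtain ⟨⟨hx0, -⟩, z, rfl⟩ := extremePoints_convexHull_subset hx
      refine ⟨fun j => (z j).toNat, ?_⟩
      ext j
      have h1 : (0 : ℝ) ≤ (z j : ℝ) := hx0 j
      have h2 : ((z j).toNat : ℤ) = z j := Int.toNat_of_nonneg (by exact_mod_cast h1)
      simp only [ι]
      exact_mod_cast h2
    have himage : ι '' (ι ⁻¹' E) = E := Set.image_preimage_eq_of_subset hEι
    obtain ⟨hfin, hcard⟩ := ncard_rigid_le_real hM hN hA (V := ι ⁻¹' E)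
      (fun x hx => isRigid_of_mem_extremePoints hx) fun x hx y hy => by
        have h1 := (extremePoints_convexHull_subset hx).1.2
        have h2 := (extremePoints_convexHull_subset hy).1.2
        have h3 := map_intCast_mulVec A fun j => (x j : ℤ)
        have h4 := map_intCast_mulVec A fun j => (y j : ℤ)
        simp only [Int.cast_natCast] at h3 h4
        have h5 := h3.symm.trans ((h1.trans h2.symm).trans h4)
        ext i
        exact_mod_cast congrFun h5 i
    rw [← himage]
    exact ⟨hfin.image _, by rwa [Set.ncard_image_of_injective _ hι]⟩
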